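/- Let $k$ be an algebraically closed field of characteristic zero, $G$ a finite group, $S\subseteq G$ a subgroup, and $\alpha: S\times S\to k^{*}$ a 2-cocycle (trivial action of $S$ on $k^*$) which is non-degenerate, i.e. $1$ is the only $s\in S$ such that $\alpha(s,t)=\alpha(t,s)$ for all $t\in C_S(s)$. Let $k_\alpha S$ be the twisted group algebra, with basis $(x_s)_{s\in S}$ and multiplication $x_sx_t=\alpha(s,t)x_{st}$, on which $S$ acts by $s\triangleright a=x_s a x_s^{-1}$. Let $$A=A(G,S,\alpha)=\{f:G\to k_\alpha S \;:\; f(sg)=s\triangleright f(g)\ \text{ for all } s\in S,\ g\in G\}$$ with pointwise operations and the $G$-action $(g\cdot f)(h)=f(hg)$. Let $k^G$ be the Hopf algebra of functions $G\to k$, with basis of idempotents $(e_g)_{g\in G}$, coacting on $A$ by $\rho(a)=\sum_{g\in G} g\cdot a\otimes e_g$. Then $A$ is a right $k^G$-Galois object: its coinvariants are $k$, and the canonical map $\mathrm{can}:A\otimes A\to A\otimes k^G$, $x\otimes y\mapsto (x\otimes 1)\rho(y)$, is bijective. The Miyashita–Ulbrich action of $k^G$ on $A$ is therefore defined, by $a\leftharpoonup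 h=h^{[1]}\,a\,h^{[2]}$, where $\mathrm{can}(h^{[1]}\otimes h^{[2]})=1\otimes h$. Let $G\times_S S$ be the quotient of $G\times S$ by the relation $(g,s)\sim(gt^{-1},tst^{-1})$, $t\in S$. For a subgroup $F\subseteq G$, a class $(g,s)\in G\times_S S$ is called $(\alpha,F)$-regular if $\alpha(s,t)=\alpha(t,s)$ for all $t\in C_S(s)\cap g^{-1}Fg$; this does not depend on the representative. **Theorem.** Let $F\subseteq G$ be any subgroup, not necessarily normal. The subalgebra $A^F$ of $F$-invariants is a $k^G$-submodule of $A$ under the Miyashita–Ulbrich action if and only if $g^{-1}Fg\subseteq C_G(s)$ for every $(\alpha,F)$-regular class $(g,s)\in G\times_S S$. -/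

import Mathlib

open scoped TensorProduct

noncomputable section

/-- A 2-cocycle `α ∈ Z²(S, kˣ)` for the trivial action of `S` on `kˣ`. -/
structure TwoCocycle (S k : Type*) [Group S] [Field k] where
  toFun : S → S → kˣ
  cocycle : ∀ s t u : S, toFun s t * toFun (s * t) u = toFun t u * toFun s (t * u)

namespace TwoCocycle

variable {S k : Type*} [Group S] [Field k]

instance : CoeFun (TwoCocycle S k) (fun _ => S → S → kˣ) := ⟨TwoCocycle.toFun⟩

/-- `s` is `α`-regular: `α(s,t) = α(t,s)` for all `t` in the centralizer of `s`. -/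
def IsRegular (α : TwoCocycle S k) (s : S) : Prop :=
  ∀ t ∈ Subgroup.centralizer {s}, α s t = α t s

/-- `α` is non-degenerate: `1` is the only `α`-regular element. -/
def IsNondegenerate (α : TwoCocycle S k) : Prop :=
  ∀ s : S, α.IsRegular s ↔ s = 1

theorem map_one_left (α : TwoCocycle S k) (t : S) : α 1 t = α 1 1 := by
  have h := α.cocycle 1 1 t
  simp only [one_mul] at h
  rw [mul_comm] at h
  exact (mul_left_cancel h).symm

theorem map_one_right (α : TwoCocycle S k) (s : S) : α s 1 = α 1 1 := by
  have h := α.cocycle s 1 1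
  simp only [mul_one] at h
  exact mul_right_cancel h

end TwoCocycle

/-- The twisted group algebra `k_α S`: the vector space with basis `(x_s)_{s ∈ S}`. -/
def TwistedGroupAlgebra {S k : Type*} [Group S] [Field k] (_α : TwoCocycle S k) : Type _ :=
  S →₀ k

namespace TwistedGroupAlgebra

variable {S k : Type*} [Group S] [Field k] (α : TwoCocycle S k)

instance : AddCommGroup (TwistedGroupAlgebra α) := inferInstanceAs (AddCommGroup (S →₀ k))

instance : Module k (TwistedGroupAlgebra α) := inferInstanceAs (Module k (S →₀ k))

/-- The basis of `k_α S` indexed by `S`. -/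
def basis : Module.Basis S k (TwistedGroupAlgebra α) := ⟨LinearEquiv.refl k (S →₀ k)⟩

/-- The basis element `x_s`. -/
def x (s : S) : TwistedGroupAlgebra α := basis α s

/-- The bilinear multiplication with `x_s x_t = α(s,t) x_{st}`. -/
def mulHom : TwistedGroupAlgebra α →ₗ[k] TwistedGroupAlgebra α →ₗ[k] TwistedGroupAlgebra α :=
  (basis α).constr k fun s => (basis α).constr k fun t => (α s t : k) • x α (s * t)

theorem mulHom_x (s t : S) : mulHom α (x α s) (x α t) = (α s t : k) • x α (s * t) := by
  simp [mulHom, x, Module.Basis.constr_basis]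

instance : Mul (TwistedGroupAlgebra α) := ⟨fun a b => mulHom α a b⟩

/-- The identity is `α(1,1)⁻¹ x_1`; it is `x_1` when `α` is normalized. -/
instance : One (TwistedGroupAlgebra α) := ⟨((α 1 1)⁻¹ : kˣ) • x α 1⟩

theorem mul_def (a b : TwistedGroupAlgebra α) : a * b = mulHom α a b := rfl

theorem one_def : (1 : TwistedGroupAlgebra α) = (((α 1 1)⁻¹ : kˣ) : k) • x α 1 := rfl

theorem x_mul_x (s t : S) : x α s * x α t = (α s t : k) • x α (s * t) := mulHom_x α s t

variable {α} in
theorem induction {p : TwistedGroupAlgebra α → Prop} (h0 : p 0)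
    (hadd : ∀ a b, p a → p b → p (a + b)) (hx : ∀ (c : k) (s : S), p (c • x α s))
    (a : TwistedGroupAlgebra α) : p a := by
  have ha : a ∈ Submodule.span k (Set.range (basis α)) := (basis α).mem_span a
  rw [← Finsupp.range_linearCombination] at ha
  obtain ⟨f, rfl⟩ := ha
  induction f using Finsupp.induction_linear with
  | zero => simpa using h0
  | add f g hf hg => rw [map_add]; exact hadd _ _ hf hg
  | single s c => rw [Finsupp.linearCombination_single]; exact hx c s

theorem mulHom_assoc (a b c : TwistedGroupAlgebra α) :
    mulHom α (mulHom α a b) c = mulHom α a (mulHom α b c) := by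
  induction a using induction with
  | h0 => simp
  | hadd a a' h h' => simp [h, h']
  | hx r s =>
    induction b using induction with
    | h0 => simp
    | hadd a a' h h' => simp only [map_add, LinearMap.add_apply, h, h']
    | hx r' t =>
      induction c using induction with
      | h0 => simp
      | hadd a a' h h' => simp only [map_add, h, h']
      | hx r'' u =>
        have h := congrArg (Units.val) (α.cocycle s t u)
        simp only [Units.val_mul] at h
        simp only [map_smul, LinearMap.smul_apply, mulHom_x, smul_smul, mul_assoc]
        congr 1
        linear_combination (r * r' * r'') * h

theorem mulHom_one_left (a : TwistedGroupAlgebra α) : mulHom α 1 a = a := by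
  induction a using induction with
  | h0 => simp
  | hadd a a' h h' => simp [h, h']
  | hx r s =>
    simp [one_def, mulHom_x, α.map_one_left, smul_smul]

theorem mulHom_one_right (a : TwistedGroupAlgebra α) : mulHom α a 1 = a := by
  induction a using induction with
  | h0 => simp
  | hadd a a' h h' => simp [h, h']
  | hx r s =>
    simp [one_def, mulHom_x, α.map_one_right, smul_smul, mul_left_comm _ r]

instance : Ring (TwistedGroupAlgebra α) :=
  { (inferInstance : AddCommGroup (TwistedGroupAlgebra α)),
    (inferInstance : Mul (TwistedGroupAlgebra α)),
    (inferInstance : One (TwistedGroupAlgebra α)) with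
    left_distrib := fun a b c => map_add (mulHom α a) b c
    right_distrib := fun a b c => LinearMap.map_add₂ (mulHom α) a b c
    zero_mul := fun a => LinearMap.map_zero₂ (mulHom α) a
    mul_zero := fun a => map_zero (mulHom α a)
    mul_assoc := mulHom_assoc α
    one_mul := mulHom_one_left α
    mul_one := mulHom_one_right α }

instance : Algebra k (TwistedGroupAlgebra α) :=
  Algebra.ofModule (fun r a b => LinearMap.map_smul₂ (mulHom α) r a b)
    (fun r a b => map_smul (mulHom α a) r b)

/-- The basis element `x_s` as a unit of `k_α S`. -/
def xUnit (s : S) : (TwistedGroupAlgebra α)ˣ where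
  val := x α s
  inv := ((((α s s⁻¹)⁻¹ * (α 1 1)⁻¹ : kˣ)) : k) • x α s⁻¹
  val_inv := by
    rw [mul_smul_comm, x_mul_x, smul_smul, mul_inv_cancel, one_def, ← Units.val_mul]
    congr 2
    rw [mul_right_comm, inv_mul_cancel, one_mul]
  inv_val := by
    have h : α s s⁻¹ = α s⁻¹ s := by
      have := α.cocycle s s⁻¹ s
      simpa [α.map_one_left, α.map_one_right, mul_comm] using this
    rw [smul_mul_assoc, x_mul_x, smul_smul, inv_mul_cancel, one_def, ← Units.val_mul]
    congr 2
    rw [h, mul_right_comm, inv_mul_cancel, one_mul]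

theorem val_xUnit (s : S) : (xUnit α s : TwistedGroupAlgebra α) = x α s := rfl

/-- The left action `s ▷ a = x_s a x_s⁻¹` of `S` on `k_α S` by algebra automorphisms. -/
def act (s : S) (a : TwistedGroupAlgebra α) : TwistedGroupAlgebra α :=
  xUnit α s * a * ((xUnit α s)⁻¹ : (TwistedGroupAlgebra α)ˣ)

theorem x_ne_zero (s : S) : x α s ≠ 0 := (basis α).ne_zero s

theorem act_x (t s : S) :
    ∃ c : kˣ, act α t (x α s) = (c : k) • x α (t * s * t⁻¹) := by
  refine ⟨α t s * (α (t * s * t⁻¹) t)⁻¹, ?_⟩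
  rw [act, Units.mul_inv_eq_iff_eq_mul]
  simp only [val_xUnit, smul_mul_assoc, x_mul_x, smul_smul, inv_mul_cancel_right]
  rw [← Units.val_mul, inv_mul_cancel_right]

theorem act_mul (s : S) (a b : TwistedGroupAlgebra α) :
    act α s (a * b) = act α s a * act α s b := by
  simp only [act, mul_assoc, Units.inv_mul_cancel_left]

/-- For commuting `s`, `t`, the condition `α(s,t) = α(t,s)` says that `x_s` and `x_t` commute. -/
theorem eq_iff_commute {s t : S} (h : Commute s t) :
    α s t = α t s ↔ Commute (x α s) (x α t) := by
  rw [Commute, SemiconjBy, x_mul_x, x_mul_x, h.eq]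
  constructor
  · intro e; rw [e]
  · intro e
    exact Units.ext (smul_left_injective k (x_ne_zero α (t * s)) e)

end TwistedGroupAlgebra

section GaloisObject

variable {G : Type*} [Group G] {k : Type*} [Field k]

/-- The algebra `A(G,S,α)` of functions `f : G → k_α S` with `f (s g) = s ▷ f g`
for all `s ∈ S`, `g ∈ G`, with pointwise operations. -/
def galoisAlgebra (S : Subgroup G) (α : TwoCocycle S k) :
    Subalgebra k (G → TwistedGroupAlgebra α) where
  carrier := {f | ∀ (s : S) (g : G), f (s * g) = TwistedGroupAlgebra.act α s (f g)}
  mul_mem' := by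
    intro a b ha hb s g
    simp only [Pi.mul_apply, ha s g, hb s g, TwistedGroupAlgebra.act_mul]
  add_mem' := by
    intro a b ha hb s g
    simp only [Pi.add_apply, ha s g, hb s g, TwistedGroupAlgebra.act, mul_add, add_mul]
  algebraMap_mem' := by
    intro r s g
    simp only [Pi.algebraMap_apply, TwistedGroupAlgebra.act]
    rw [← Algebra.commutes r, mul_assoc, Units.mul_inv, mul_one]

/-- The action `(g • f) h = f (h g)` of `G` on `A(G,S,α)` by algebra automorphisms. -/
instance (S : Subgroup G) (α : TwoCocycle S k) : MulSemiringAction G (galoisAlgebra S α) where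
  smul g f := ⟨fun h => f.1 (h * g), fun s h => by
    change f.1 (s * h * g) = _
    rw [mul_assoc]; exact f.2 s (h * g)⟩
  one_smul f := Subtype.ext (funext fun h => congrArg f.1 (mul_one h))
  mul_smul g g' f := Subtype.ext (funext fun h => congrArg f.1 (mul_assoc h g g').symm)
  smul_zero _ := rfl
  smul_add _ _ _ := rfl
  smul_one _ := rfl
  smul_mul _ _ _ := rfl

theorem galoisAlgebra_smul_apply {S : Subgroup G} {α : TwoCocycle S k} (g : G)
    (f : galoisAlgebra S α) (h : G) : (g • f).1 h = f.1 (h * g) := rfl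

instance (S : Subgroup G) (α : TwoCocycle S k) : SMulCommClass G k (galoisAlgebra S α) :=
  ⟨fun _ _ _ => rfl⟩

end GaloisObject

section HopfGalois

/-! For a `G`-module algebra `A`, regarded as a right comodule algebra over the Hopf algebra
`k^G` of functions `G → k`. -/

variable (k G : Type*) [Field k] [Group G] [Fintype G] [DecidableEq G]
  {A : Type*} [Ring A] [Algebra k A] [MulSemiringAction G A] [SMulCommClass G k A]

/-- The coaction `ρ(a) = ∑ g, g • a ⊗ e_g`, where `e_g ∈ k^G` is the indicator function of `g`. -/
def coaction : A →ₗ[k] A ⊗[k] (G → k) :=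
  ∑ g : G, (TensorProduct.mk k A (G → k)).flip (Pi.single g 1) ∘ₗ
    DistribSMul.toLinearMap k A g

variable (A) in
/-- The canonical map `can (x ⊗ y) = x y₍₀₎ ⊗ y₍₁₎`, i.e. `(x ⊗ 1) ρ(y)`. -/
def canonicalMap : A ⊗[k] A →ₗ[k] A ⊗[k] (G → k) :=
  LinearMap.mul' k (A ⊗[k] (G → k)) ∘ₗ
    TensorProduct.map (Algebra.TensorProduct.includeLeft (R := k) (S := k)).toLinearMap
      (coaction k G)

theorem coaction_apply (a : A) :
    coaction k G a = ∑ g : G, (g • a) ⊗ₜ[k] (Pi.single g (1 : k) : G → k) := by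
  simp [coaction]

theorem canonicalMap_tmul (a b : A) :
    canonicalMap k G A (a ⊗ₜ b) =
      ∑ g : G, (a * g • b) ⊗ₜ[k] (Pi.single g (1 : k) : G → k) := by
  simp [canonicalMap, coaction_apply, Finset.mul_sum]

variable (A) in
/-- `A` is a right `k^G`-Galois object: its algebra of coinvariants is the base field, and the
canonical map is bijective. -/
structure IsGaloisObject : Prop where
  coinvariants : ∀ a : A, coaction k G a = a ⊗ₜ 1 ↔ a ∈ (⊥ : Subalgebra k A)
  bijective : Function.Bijective (canonicalMap k G A)

variable {k G}

/-- The element `h^[1] ⊗ h^[2]` of `A ⊗ A` determined by `can (h^[1] ⊗ h^[2]) = 1 ⊗ h`. -/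
def IsGaloisObject.translation (hA : IsGaloisObject k G A) (h : G → k) : A ⊗[k] A :=
  (LinearEquiv.ofBijective (canonicalMap k G A) hA.bijective).symm (1 ⊗ₜ h)

/-- The Miyashita-Ulbrich action `a ↼ h = h^[1] a h^[2]` of `k^G` on a Galois object. -/
def IsGaloisObject.miyashitaUlbrich (hA : IsGaloisObject k G A) (a : A) (h : G → k) : A :=
  TensorProduct.lift (LinearMap.mul k A ∘ₗ LinearMap.mulRight k a) (hA.translation h)

/-- The subspace `B` is a `k^G`-submodule of `A` for the Miyashita-Ulbrich action. -/
def IsGaloisObject.IsMUSubmodule (hA : IsGaloisObject k G A) (B : Submodule k A) : Prop :=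
  ∀ a ∈ B, ∀ h : G → k, hA.miyashitaUlbrich a h ∈ B

end HopfGalois

section FiberProduct

variable {G : Type*} [Group G]

/-- The relation on `G × S` with `(g, s) ∼ (g t⁻¹, t s t⁻¹)` for `t ∈ S`. -/
def balancedSetoid (S : Subgroup G) : Setoid (G × S) where
  r p q := ∃ t : S, q = (p.1 * (t : G)⁻¹, t * p.2 * t⁻¹)
  iseqv :=
    { refl := fun p => ⟨1, by simp⟩
      symm := by
        rintro p q ⟨t, rfl⟩
        exact ⟨t⁻¹, by simp [mul_assoc]⟩
      trans := by
        rintro p q r ⟨t, rfl⟩ ⟨u, rfl⟩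
        exact ⟨u * t, by simp [mul_assoc]⟩ }

/-- The set `G ×_S S` of classes `(g, s)`. -/
def BalancedProduct (S : Subgroup G) : Type _ := Quotient (balancedSetoid S)

/-- The class of `(g, s)` in `G ×_S S`. -/
def BalancedProduct.mk {S : Subgroup G} (g : G) (s : S) : BalancedProduct S :=
  Quotient.mk (balancedSetoid S) (g, s)

/-- The subgroup `g⁻¹ F g`. -/
def conjInv (g : G) (F : Subgroup G) : Subgroup G := F.map (MulAut.conj g⁻¹).toMonoidHom

theorem mem_conjInv {g r : G} {F : Subgroup G} : r ∈ conjInv g F ↔ g * r * g⁻¹ ∈ F := by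
  simp only [conjInv, Subgroup.mem_map, MulEquiv.coe_toMonoidHom, MulAut.conj_apply, inv_inv]
  constructor
  · rintro ⟨f, hf, rfl⟩
    simpa [mul_assoc] using hf
  · intro h
    exact ⟨_, h, by simp [mul_assoc]⟩

variable {k : Type*} [Field k]

/-- The pair `(g, s)` is `(α,F)`-regular: `α(s,t) = α(t,s)` for all `t ∈ C_S(s) ∩ g⁻¹ F g`. -/
def IsRegularPair {S : Subgroup G} (α : TwoCocycle S k) (F : Subgroup G) (p : G × S) : Prop :=
  ∀ t ∈ Subgroup.centralizer {p.2}, (t : G) ∈ conjInv p.1 F → α p.2 t = α t p.2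

theorem IsRegularPair.move {S : Subgroup G} {α : TwoCocycle S k} {F : Subgroup G}
    {p q : G × S} (hpq : (balancedSetoid S).r p q) (hp : IsRegularPair α F p) :
    IsRegularPair α F q := by
  obtain ⟨t, rfl⟩ := hpq
  obtain ⟨g, s⟩ := p
  intro r hr hrF
  simp only at hr hrF ⊢
  obtain ⟨r', rfl⟩ : ∃ r', r = t * r' * t⁻¹ := ⟨t⁻¹ * r * t, by group⟩
  have hc : Commute s r' := by
    have h := Subgroup.mem_centralizer_singleton_iff.1 hr
    have h' : t * (r' * s) * t⁻¹ = t * (s * r') * t⁻¹ := by simpa [mul_assoc] using h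
    exact (mul_left_cancel (mul_right_cancel h')).symm
  have hreg := hp r' (Subgroup.mem_centralizer_singleton_iff.2 hc.eq.symm)
    (by rw [mem_conjInv] at hrF ⊢; simpa [mul_assoc] using hrF)
  rw [TwistedGroupAlgebra.eq_iff_commute α hc] at hreg
  rw [TwistedGroupAlgebra.eq_iff_commute α (by simpa [Commute, SemiconjBy] using hc)]
  obtain ⟨c, hc⟩ := TwistedGroupAlgebra.act_x α t s
  obtain ⟨d, hd⟩ := TwistedGroupAlgebra.act_x α t r'
  have h : Commute ((c : k) • TwistedGroupAlgebra.x α (t * s * t⁻¹))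
      ((d : k) • TwistedGroupAlgebra.x α (t * r' * t⁻¹)) := by
    rw [← hc, ← hd, Commute, SemiconjBy, ← TwistedGroupAlgebra.act_mul,
      ← TwistedGroupAlgebra.act_mul, hreg.eq]
  have h' := (h.smul_left ((c : k)⁻¹)).smul_right ((d : k)⁻¹)
  simpa [smul_smul] using h'

/-- The class `(g, s) ∈ G ×_S S` is `(α,F)`-regular; this depends only on the class. -/
def IsRegularClass {S : Subgroup G} (α : TwoCocycle S k) (F : Subgroup G) :
    BalancedProduct S → Prop :=
  Quotient.lift (IsRegularPair α F) fun _ _ h =>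
    propext ⟨IsRegularPair.move h, IsRegularPair.move ((balancedSetoid S).symm h)⟩

end FiberProduct

end

/-! The Miyashita–Ulbrich action becomes visible through the grading of `k_α S` by `S`: the
idempotent e_g replaces each value a(q) by its component on the line of x_{qgq⁻¹}, or by 0 when
qgq⁻¹ ∉ S (`miyashitaUlbrich_eq`). This formula and the surjectivity of can both come from one
identity, `sum_single_mul_smul_single`. Its source is averaging: by non-degeneracy, summing over all
S-conjugates kills every x_s with s ≠ 1 (`sum_act`). Injectivity of can follows by counting
dimensions.

So A^F is a submodule exactly when it is stable under every `component w`. Let a be F-invariant, f ∈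
F and r = qfq⁻¹. Then a(qf) = a(q), but the index qwq⁻¹ read at q becomes its conjugate by r at qf.
Distinct lines being independent, stability means that r commutes with every s such that x_s occurs
in a(q). The s that occur at q in some invariant are exactly those with (q⁻¹, s) regular
(`isRegularPair_of_proj_ne_zero`, `exists_mem_fixed_proj_ne_zero`), which gives the criterion. -/

noncomputable section

/-! ### Conjugation and coordinate lines in the twisted group algebra. -/

namespace TwistedGroupAlgebra

variable {S k : Type*} [Group S] [Field k] (α : TwoCocycle S k)

theorem act_mul_x (s : S) (a : TwistedGroupAlgebra α) : act α s a * x α s = x α s * a := by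
  rw [← val_xUnit, act, Units.inv_mul_cancel_right]

theorem act_eq_iff {s : S} {a b : TwistedGroupAlgebra α} :
    act α s a = b ↔ x α s * a = b * x α s := by
  rw [act, Units.mul_inv_eq_iff_eq_mul, val_xUnit]

theorem act_comp (s t : S) (a : TwistedGroupAlgebra α) :
    act α (s * t) a = act α s (act α t a) := by
  have hx : x α (s * t) = (((α s t)⁻¹ : kˣ) : k) • (x α s * x α t) := by
    rw [x_mul_x, smul_smul, Units.inv_mul, one_smul]
  rw [act_eq_iff, hx, smul_mul_assoc, mul_smul_comm, ← mul_assoc (act α s _), act_mul_x,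
    mul_assoc (x α s) (act α t a), act_mul_x, mul_assoc]

theorem act_one_left (a : TwistedGroupAlgebra α) : act α 1 a = a := by
  have hx : x α 1 = ((α 1 1 : kˣ) : k) • (1 : TwistedGroupAlgebra α) := by
    rw [one_def, smul_smul, Units.mul_inv, one_smul]
  rw [act_eq_iff, hx]
  simp

theorem act_eq_self_iff_commute {s : S} {a : TwistedGroupAlgebra α} :
    act α s a = a ↔ Commute (x α s) a :=
  act_eq_iff α

variable {α} in
theorem hom_ext {M : Type*} [AddCommMonoid M] [Module k M] {f g : TwistedGroupAlgebra α →ₗ[k] M}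
    (h : ∀ s, f (x α s) = g (x α s)) : f = g :=
  (basis α).ext h

/-- The action of `s` as a linear map. -/
def actHom (s : S) : TwistedGroupAlgebra α →ₗ[k] TwistedGroupAlgebra α where
  toFun := act α s
  map_add' a b := by simp only [act, mul_add, add_mul]
  map_smul' c a := by simp only [act, mul_smul_comm, smul_mul_assoc, RingHom.id_apply]

theorem actHom_apply (s : S) (a : TwistedGroupAlgebra α) : actHom α s a = act α s a := rfl

/-- The projection of `k_α S` onto the line spanned by `x_s`. -/
def proj (s : S) : TwistedGroupAlgebra α →ₗ[k] TwistedGroupAlgebra α :=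
  (basis α).coord s |>.smulRight (x α s)

theorem proj_apply (s : S) (a : TwistedGroupAlgebra α) :
    proj α s a = (basis α).coord s a • x α s := rfl

theorem coord_x [DecidableEq S] (s t : S) :
    (basis α).coord s (x α t) = if t = s then 1 else 0 := by
  rw [x, Module.Basis.coord_apply, Module.Basis.repr_self, Finsupp.single_apply]

theorem proj_x_self (s : S) : proj α s (x α s) = x α s := by
  classical rw [proj_apply, coord_x, if_pos rfl, one_smul]

theorem proj_x_of_ne {s t : S} (h : t ≠ s) : proj α s (x α t) = 0 := by
  classical rw [proj_apply, coord_x, if_neg h, zero_smul]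

theorem proj_proj_self (s : S) (a : TwistedGroupAlgebra α) :
    proj α s (proj α s a) = proj α s a := by
  rw [proj_apply α s a, map_smul, proj_x_self]

theorem proj_proj_of_ne {s t : S} (h : t ≠ s) (a : TwistedGroupAlgebra α) :
    proj α s (proj α t a) = 0 := by
  rw [proj_apply α t a, map_smul, proj_x_of_ne α h, smul_zero]

/-- Conjugation by x_t permutes the coordinate lines, carrying the line of x_s to that of x_{tst⁻¹}.
-/
theorem proj_conj_act (s t : S) (a : TwistedGroupAlgebra α) :
    proj α (t * s * t⁻¹) (act α t a) = act α t (proj α s a) := by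
  suffices h : proj α (t * s * t⁻¹) ∘ₗ actHom α t = actHom α t ∘ₗ proj α s from
    LinearMap.congr_fun h a
  refine hom_ext fun r => ?_
  rw [LinearMap.comp_apply, LinearMap.comp_apply, actHom_apply, actHom_apply]
  obtain ⟨c, hc⟩ := act_x α t r
  by_cases hr : r = s
  · subst hr
    rw [proj_x_self, hc, map_smul, proj_x_self]
  · rw [proj_x_of_ne α hr, hc, map_smul, proj_x_of_ne, smul_zero, ← actHom_apply, map_zero]
    simpa using hr

/-! ### Averaging over conjugates under non-degeneracy. -/

variable {α} in
theorem sum_act_x_of_ne_one [Fintype S] (hα : α.IsNondegenerate) {s : S} (hs : s ≠ 1) :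
    ∑ r : S, act α r (x α s) = 0 := by
  have hreg : ¬ α.IsRegular s := fun h => hs ((hα s).1 h)
  unfold TwoCocycle.IsRegular at hreg
  push Not at hreg
  obtain ⟨t, ht, hne⟩ := hreg
  have hcomm : t * s = s * t := Subgroup.mem_centralizer_singleton_iff.1 ht
  obtain ⟨c, hc⟩ := act_x α t s
  rw [hcomm, mul_inv_cancel_right] at hc
  have hc1 : (c : k) ≠ 1 := by
    intro h
    rw [h, one_smul, act_eq_self_iff_commute] at hc
    exact hne ((eq_iff_commute α hcomm.symm).2 hc.symm)
  -- Some t commuting with s scales x_s by c ≠ 1. Reindexing r ↦ rt multiplies the sum by c without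
  -- changing it, so it vanishes.
  have key : ∑ r : S, act α r (x α s) = (c : k) • ∑ r : S, act α r (x α s) := by
    conv_lhs => rw [← Equiv.sum_comp (Equiv.mulRight t)]
    rw [Finset.smul_sum]
    refine Finset.sum_congr rfl fun r _ => ?_
    rw [Equiv.coe_mulRight, act_comp, hc, ← actHom_apply, map_smul]
    rfl
  have h0 : ((c : k) - 1) • ∑ r : S, act α r (x α s) = 0 := by
    rw [sub_smul, ← key, one_smul, sub_self]
  exact (smul_eq_zero.1 h0).resolve_left (sub_ne_zero.2 hc1)

variable {α} in
theorem sum_act_x_one [Fintype S] :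
    ∑ r : S, act α r (x α 1) = (Fintype.card S : k) • x α 1 := by
  have h (r : S) : act α r (x α 1) = x α 1 := by
    rw [act_eq_self_iff_commute, Commute, SemiconjBy, x_mul_x, x_mul_x, α.map_one_left,
      α.map_one_right, one_mul, mul_one]
  simp [h, Nat.cast_smul_eq_nsmul]

variable {α} in
/-- The sum of the conjugates of `a` is a scalar. -/
theorem sum_act [Fintype S] (hα : α.IsNondegenerate) (a : TwistedGroupAlgebra α) :
    ∑ r : S, act α r a = (Fintype.card S : k) • proj α 1 a := by
  suffices h : ∑ r : S, actHom α r = (Fintype.card S : k) • proj α 1 by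
    simpa only [LinearMap.sum_apply, LinearMap.smul_apply, actHom_apply] using
      LinearMap.congr_fun h a
  refine hom_ext fun s => ?_
  simp only [LinearMap.sum_apply, LinearMap.smul_apply, actHom_apply]
  by_cases hs : s = 1
  · subst hs
    rw [sum_act_x_one, proj_x_self]
  · rw [sum_act_x_of_ne_one hα hs, proj_x_of_ne α hs, smul_zero]

-- Each summand equals x_r (a x_u) x_r⁻¹ · x_u⁻¹, so the averaging formula extracts the x_1 part of
-- a x_u. That is the x_{u⁻¹} part of a, multiplied by x_u.
variable {α} in
theorem sum_x_mul_act_inv [Fintype S] (hα : α.IsNondegenerate) (u : S)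
    (a : TwistedGroupAlgebra α) :
    ∑ r : S, x α r * a * act α u ((xUnit α r)⁻¹ : (TwistedGroupAlgebra α)ˣ) =
      (Fintype.card S : k) • proj α u⁻¹ a := by
  have h1 (r : S) : x α r * a * act α u ((xUnit α r)⁻¹ : (TwistedGroupAlgebra α)ˣ) =
      act α r (a * x α u) * ((xUnit α u)⁻¹ : (TwistedGroupAlgebra α)ˣ) := by
    simp only [act, val_xUnit, mul_assoc]
  simp only [h1]
  rw [← Finset.sum_mul, sum_act hα, smul_mul_assoc]
  congr 1
  rw [Units.mul_inv_eq_iff_eq_mul, val_xUnit]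
  suffices h : proj α 1 ∘ₗ LinearMap.mulRight k (x α u) =
      LinearMap.mulRight k (x α u) ∘ₗ proj α u⁻¹ from LinearMap.congr_fun h a
  refine hom_ext fun s => ?_
  rw [LinearMap.comp_apply, LinearMap.comp_apply, LinearMap.mulRight_apply,
    LinearMap.mulRight_apply]
  rw [x_mul_x, map_smul]
  by_cases hs : s = u⁻¹
  · subst hs
    rw [proj_x_self, x_mul_x, inv_mul_cancel, proj_x_self]
  · rw [proj_x_of_ne α hs, zero_mul, proj_x_of_ne, smul_zero]
    rwa [Ne, mul_eq_one_iff_eq_inv]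

theorem proj_one_one : proj α 1 (1 : TwistedGroupAlgebra α) = 1 := by
  rw [one_def, map_smul, proj_x_self]

theorem proj_one_of_ne {s : S} (hs : s ≠ 1) : proj α s (1 : TwistedGroupAlgebra α) = 0 := by
  rw [one_def, map_smul, proj_x_of_ne α hs.symm, smul_zero]

theorem x_one_mem_bot : x α 1 ∈ (⊥ : Subalgebra k (TwistedGroupAlgebra α)) := by
  have hx : x α 1 = ((α 1 1 : kˣ) : k) • (1 : TwistedGroupAlgebra α) := by
    rw [one_def, smul_smul, Units.mul_inv, one_smul]
  rw [hx]
  exact Subalgebra.smul_mem _ (one_mem _) _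

variable {α} in
/-- The center of `k_α S` is `k` when `α` is non-degenerate. -/
theorem mem_bot_of_act_eq [Finite S] [CharZero k] (hα : α.IsNondegenerate)
    {a : TwistedGroupAlgebra α} (ha : ∀ s : S, act α s a = a) :
    a ∈ (⊥ : Subalgebra k (TwistedGroupAlgebra α)) := by
  have := Fintype.ofFinite S
  have h := sum_act hα a
  simp only [ha, Finset.sum_const, Finset.card_univ, ← Nat.cast_smul_eq_nsmul k] at h
  have h' := smul_right_injective _ (Nat.cast_ne_zero.2 (Fintype.card_ne_zero (α := S))) h
  rw [h', proj_apply]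
  exact Subalgebra.smul_mem _ (x_one_mem_bot α) _

end TwistedGroupAlgebra

/-! ### Linear algebra of the canonical map and the coaction. -/

theorem canonicalMap_bijective_of_surjective {k G A : Type*} [Field k] [Group G] [Fintype G]
    [DecidableEq G] [Ring A] [Algebra k A] [MulSemiringAction G A] [SMulCommClass G k A]
    [Module.Finite k A] (hA : Module.finrank k A ≤ Fintype.card G)
    (hs : Function.Surjective (canonicalMap k G A)) : Function.Bijective (canonicalMap k G A) := by
  refine ⟨?_, hs⟩
  have hle : Module.finrank k (A ⊗[k] A) ≤ Module.finrank k (A ⊗[k] (G → k)) := by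
    rw [Module.finrank_tensorProduct, Module.finrank_tensorProduct,
      Module.finrank_fintype_fun_eq_card]
    exact Nat.mul_le_mul_left _ hA
  have heq := hle.antisymm (LinearMap.finrank_le_finrank_of_surjective hs)
  exact (LinearMap.injective_iff_surjective_of_finrank_eq_finrank heq).2 hs

/-- Evaluating the second tensor factor at g isolates the term g • a of the coaction. -/
theorem smul_eq_of_coaction_eq {k G A : Type*} [Field k] [Group G] [Fintype G]
    [DecidableEq G] [Ring A] [Algebra k A] [MulSemiringAction G A] [SMulCommClass G k A]
    {a : A} (h : coaction k G a = a ⊗ₜ 1) (g : G) : g • a = a := by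
  have h' := congrArg (fun t => TensorProduct.rid k A
    ((LinearMap.proj g : (G → k) →ₗ[k] k).lTensor A t)) h
  simpa [coaction_apply, Pi.single_apply, ite_smul] using h'

/-! ### Evaluation, functions supported on one coset, and graded components. -/

namespace galoisAlgebra

open TwistedGroupAlgebra

variable {G : Type*} [Group G] {k : Type*} [Field k] {S : Subgroup G} {α : TwoCocycle S k}

/-- Evaluation at `q`. -/
def ev (q : G) : galoisAlgebra S α →ₐ[k] TwistedGroupAlgebra α :=
  (Pi.evalAlgHom k (fun _ : G => TwistedGroupAlgebra α) q).comp (galoisAlgebra S α).val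

theorem ev_smul (q g : G) (a : galoisAlgebra S α) : ev q (g • a) = ev (q * g) a := rfl

theorem ev_mul_left (s : S) (q : G) (a : galoisAlgebra S α) :
    ev (s * q) a = act α s (ev q a) := a.2 s q

theorem ext_ev {a b : galoisAlgebra S α} (h : ∀ q, ev q a = ev q b) : a = b :=
  Subtype.ext (funext h)

/-- The space of cosets `S \ G`. -/
abbrev Cosets (S : Subgroup G) : Type _ := Quotient (QuotientGroup.rightRel S)

theorem ext_out {a b : galoisAlgebra S α}
    (h : ∀ c : Cosets S, ev c.out a = ev c.out b) : a = b := by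
  refine ext_ev fun q => ?_
  have hq : q * (Quotient.mk (QuotientGroup.rightRel S) q).out⁻¹ ∈ S :=
    QuotientGroup.rightRel_apply.1 (Quotient.mk_out (s := QuotientGroup.rightRel S) q)
  have h1 := ev_mul_left ⟨_, hq⟩ (Quotient.mk (QuotientGroup.rightRel S) q).out a
  have h2 := ev_mul_left ⟨_, hq⟩ (Quotient.mk (QuotientGroup.rightRel S) q).out b
  simp only [inv_mul_cancel_right] at h1 h2
  rw [h1, h2, h]

open Classical in
/-- The function supported on the coset `S p` with value `a` at `p`. -/
def single (p : G) (a : TwistedGroupAlgebra α) : galoisAlgebra S α :=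
  ⟨fun q => if h : q * p⁻¹ ∈ S then act α ⟨q * p⁻¹, h⟩ a else 0, by
    intro s q
    by_cases h : q * p⁻¹ ∈ S
    · have h' : s * q * p⁻¹ ∈ S := by rw [mul_assoc]; exact S.mul_mem s.2 h
      simp only [dif_pos h, dif_pos h']
      rw [← act_comp]
      congr 1
      exact Subtype.ext (mul_assoc _ _ _)
    · have h' : ¬ s * q * p⁻¹ ∈ S := by
        rw [mul_assoc, Subgroup.mul_mem_cancel_left _ s.2]; exact h
      simp only [dif_neg h, dif_neg h']
      rw [← actHom_apply, map_zero]⟩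

theorem ev_single_of_mem {p q : G} (a : TwistedGroupAlgebra α) (h : q * p⁻¹ ∈ S) :
    ev q (single p a) = act α ⟨q * p⁻¹, h⟩ a :=
  dif_pos h

theorem ev_single_of_notMem {p q : G} (a : TwistedGroupAlgebra α) (h : q * p⁻¹ ∉ S) :
    ev q (single p a) = 0 :=
  dif_neg h

theorem ev_single_self (p : G) (a : TwistedGroupAlgebra α) : ev p (single p a) = a := by
  rw [ev_single_of_mem a (by rw [mul_inv_cancel]; exact S.one_mem)]
  simp only [mul_inv_cancel]
  exact act_one_left α a

open Classical in
/-- The projection of `k_α S` to the line spanned by `x_w` if `w ∈ S`, and `0` otherwise. -/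
def projAt (w : G) : TwistedGroupAlgebra α →ₗ[k] TwistedGroupAlgebra α :=
  if h : w ∈ S then proj α ⟨w, h⟩ else 0

theorem projAt_coe (s : S) : projAt (α := α) (s : G) = proj α s := dif_pos s.2

theorem projAt_of_notMem {w : G} (h : w ∉ S) : projAt (α := α) w = 0 := dif_neg h

theorem projAt_conj_act (s : S) (w : G) (a : TwistedGroupAlgebra α) :
    projAt (s * w * (s : G)⁻¹) (act α s a) = act α s (projAt w a) := by
  by_cases hw : w ∈ S
  · lift w to S using hw
    rw [projAt_coe, ← proj_conj_act, ← projAt_coe]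
    simp
  · rw [projAt_of_notMem hw, projAt_of_notMem, LinearMap.zero_apply, LinearMap.zero_apply,
      ← actHom_apply, map_zero]
    rwa [Subgroup.mul_mem_cancel_right _ (S.inv_mem s.2), Subgroup.mul_mem_cancel_left _ s.2]

theorem projAt_one [DecidableEq G] (w : G) :
    projAt w (1 : TwistedGroupAlgebra α) = if w = 1 then 1 else 0 := by
  split_ifs with h
  · subst h
    rw [← S.coe_one, projAt_coe, proj_one_one]
  · by_cases hw : w ∈ S
    · lift w to S using hw
      rw [projAt_coe, proj_one_of_ne]
      exact_mod_cast h
    · rw [projAt_of_notMem hw, LinearMap.zero_apply]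

/-- The element `q ↦ (component of a(q) along x_{q w q⁻¹})` of `A(G,S,α)`. -/
def component (w : G) (a : galoisAlgebra S α) : galoisAlgebra S α :=
  ⟨fun q => projAt (q * w * q⁻¹) (ev q a), fun s q => by
    change projAt _ (ev (s * q) a) = act α s (projAt (q * w * q⁻¹) (ev q a))
    -- Passing from q to sq conjugates the index qwq⁻¹ by s, just as `act α s` moves the lines.
    rw [ev_mul_left, ← projAt_conj_act]
    congr 2
    group⟩

theorem ev_component (q w : G) (a : galoisAlgebra S α) :
    ev q (component w a) = projAt (q * w * q⁻¹) (ev q a) := rfl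

theorem component_one [DecidableEq G] (w : G) :
    component w (1 : galoisAlgebra S α) = if w = 1 then 1 else 0 := by
  refine ext_ev fun q => ?_
  rw [ev_component, map_one, projAt_one]
  simp only [conj_eq_one_iff]
  split_ifs <;> simp

/-- The key identity, used twice: a = 1 inverts the canonical map, and g' = 1 computes the
Miyashita–Ulbrich action. At a representative c only the c-term survives. It vanishes unless u =
cg'(cg)⁻¹ lies in S, and then `sum_x_mul_act_inv` projects to the index u⁻¹ = c(gg'⁻¹)c⁻¹. -/
theorem sum_single_mul_smul_single [Fintype S] [Fintype (Cosets S)] (hα : α.IsNondegenerate)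
    (g g' : G) (a : galoisAlgebra S α) :
    ∑ c : Cosets S, ∑ r : S, single c.out (x α r) * a *
        g' • single (c.out * g) ((xUnit α r)⁻¹ : (TwistedGroupAlgebra α)ˣ).val =
      (Fintype.card S : k) • component (g * g'⁻¹) a := by
  refine ext_out fun c => ?_
  simp only [map_sum, map_mul, map_smul, ev_smul, ev_component]
  rw [Finset.sum_eq_single c]
  · simp only [ev_single_self]
    by_cases hu : c.out * g' * (c.out * g)⁻¹ ∈ S
    · simp only [ev_single_of_mem _ hu]
      rw [sum_x_mul_act_inv hα, ← projAt_coe]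
      congr 3
      simp [mul_assoc]
    · simp only [ev_single_of_notMem _ hu, mul_zero, Finset.sum_const_zero]
      rw [projAt_of_notMem, LinearMap.zero_apply, smul_zero]
      rwa [← S.inv_mem_iff, show (c.out * (g * g'⁻¹) * c.out⁻¹)⁻¹ = c.out * g' * (c.out * g)⁻¹ by
        group]
  · intro d _ hd
    refine Finset.sum_eq_zero fun r _ => ?_
    rw [ev_single_of_notMem, zero_mul, zero_mul]
    intro hmem
    apply hd
    rw [← d.out_eq, ← c.out_eq]
    exact Quotient.sound (QuotientGroup.rightRel_apply.2 hmem)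
  · simp

/-! ### Dimension bound and coinvariants. -/

/-- Evaluation at coset representatives. -/
def evOut (S : Subgroup G) (α : TwoCocycle S k) :
    galoisAlgebra S α →ₗ[k] Cosets S → TwistedGroupAlgebra α :=
  LinearMap.pi fun c => (ev c.out).toLinearMap

theorem evOut_injective : Function.Injective (evOut S α) := fun _ _ h =>
  ext_out fun c => congrFun h c

theorem finite_twistedGroupAlgebra [Finite S] : Module.Finite k (TwistedGroupAlgebra α) :=
  Module.Finite.of_basis (basis α)

theorem finite [Finite G] : Module.Finite k (galoisAlgebra S α) :=
  have := finite_twistedGroupAlgebra (α := α)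
  Module.Finite.of_injective _ evOut_injective

theorem finrank_le [Fintype G] : Module.finrank k (galoisAlgebra S α) ≤ Fintype.card G := by
  have := finite_twistedGroupAlgebra (α := α)
  have := Fintype.ofFinite S
  have := Fintype.ofFinite (Cosets S)
  refine (LinearMap.finrank_le_finrank_of_injective (evOut_injective (α := α))).trans ?_
  rw [Module.finrank_pi_fintype, Finset.sum_const, Finset.card_univ,
    Module.finrank_eq_card_basis (basis α), smul_eq_mul, ← Nat.card_eq_fintype_card,
    ← Nat.card_eq_fintype_card, ← Nat.card_eq_fintype_card,
    Nat.card_congr (QuotientGroup.quotientRightRelEquivQuotientLeftRel S),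
    ← Subgroup.card_eq_card_quotient_mul_card_subgroup]

theorem card_subgroup_ne_zero [Fintype S] [CharZero k] : (Fintype.card S : k) ≠ 0 :=
  Nat.cast_ne_zero.2 Fintype.card_ne_zero

/-- A coinvariant is G-fixed, hence a constant function. Equivariance makes its value S-invariant,
and such elements are scalars. -/
theorem coaction_eq_tmul_one_iff [Fintype G] [DecidableEq G] [CharZero k] (hα : α.IsNondegenerate)
    (a : galoisAlgebra S α) :
    coaction k G a = a ⊗ₜ 1 ↔ a ∈ (⊥ : Subalgebra k (galoisAlgebra S α)) := by
  constructor
  · intro h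
    have hfix (g : G) : g • a = a := smul_eq_of_coaction_eq h g
    have hev (q : G) : ev q a = ev 1 a := by
      conv_rhs => rw [← hfix q, ev_smul, one_mul]
    have hinv (s : S) : act α s (ev 1 a) = ev 1 a := by
      rw [← ev_mul_left, hev]
    obtain ⟨c, hc⟩ := Algebra.mem_bot.1 (mem_bot_of_act_eq hα hinv)
    refine Algebra.mem_bot.2 ⟨c, ext_ev fun q => ?_⟩
    rw [hev, ← hc, AlgHom.commutes]
  · intro h
    obtain ⟨c, rfl⟩ := Algebra.mem_bot.1 h
    have hfix (g : G) : g • (algebraMap k (galoisAlgebra S α) c) = algebraMap k _ c := by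
      rw [Algebra.algebraMap_eq_smul_one, smul_comm, smul_one]
    rw [coaction_apply]
    simp only [hfix, ← TensorProduct.tmul_sum]
    congr 1
    exact Finset.univ_sum_single 1

/-! ### The Galois property and the explicit Miyashita–Ulbrich action. -/

section Finite

variable [Fintype G] [DecidableEq G] [Fintype S] [Fintype (Cosets S)]

/-- A preimage of `a ⊗ h` under the canonical map. -/
def canonicalPreimage (a : galoisAlgebra S α) (h : G → k) :
    galoisAlgebra S α ⊗[k] galoisAlgebra S α :=
  (Fintype.card S : k)⁻¹ • ∑ g : G, h g • ∑ c : Cosets S, ∑ r : S,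
    (a * single c.out (x α r)) ⊗ₜ[k]
      single (c.out * g) ((xUnit α r)⁻¹ : (TwistedGroupAlgebra α)ˣ).val

variable [CharZero k]

theorem canonicalMap_canonicalPreimage (hα : α.IsNondegenerate) (a : galoisAlgebra S α)
    (h : G → k) : canonicalMap k G (galoisAlgebra S α) (canonicalPreimage a h) = a ⊗ₜ h := by
  have key (g : G) : ∑ c : Cosets S, ∑ r : S, ∑ g' : G,
      (a * single c.out (x α r) *
        g' • single (c.out * g) ((xUnit α r)⁻¹ : (TwistedGroupAlgebra α)ˣ).val) ⊗ₜ[k]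
          (Pi.single g' (1 : k) : G → k) =
      (Fintype.card S : k) • (a ⊗ₜ[k] (Pi.single g (1 : k) : G → k)) := by
    -- The components of 1 vanish except at index 1, so only g' = g contributes.
    have h1 (g' : G) := congrArg (a * ·) (sum_single_mul_smul_single hα g g' 1)
    simp only [mul_one, Finset.mul_sum, ← mul_assoc, component_one, mul_inv_eq_one] at h1
    have h2 (c : Cosets S) := Finset.sum_comm (s := (Finset.univ : Finset S))
      (t := (Finset.univ : Finset G)) (f := fun r g' => (a * single c.out (x α r) *
        g' • single (c.out * g) ((xUnit α r)⁻¹ : (TwistedGroupAlgebra α)ˣ).val) ⊗ₜ[k]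
          (Pi.single g' (1 : k) : G → k))
    simp only [h2]
    rw [Finset.sum_comm]
    simp only [← TensorProduct.sum_tmul, h1]
    rw [Finset.sum_eq_single g]
    · rw [if_pos rfl, mul_smul_comm, mul_one, TensorProduct.smul_tmul']
    · intro g' _ hg
      rw [if_neg hg.symm, smul_zero, mul_zero, TensorProduct.zero_tmul]
    · simp
  simp only [canonicalPreimage, map_smul, map_sum, canonicalMap_tmul, key]
  simp only [smul_comm _ (Fintype.card S : k), ← Finset.smul_sum]
  rw [smul_inv_smul₀ card_subgroup_ne_zero]
  simp only [← TensorProduct.tmul_smul, ← TensorProduct.tmul_sum]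
  congr 1
  conv_rhs => rw [← Finset.univ_sum_single h]
  refine Finset.sum_congr rfl fun g _ => ?_
  rw [← Pi.single_smul, smul_eq_mul, mul_one]

theorem canonicalMap_surjective (hα : α.IsNondegenerate) :
    Function.Surjective (canonicalMap k G (galoisAlgebra S α)) := by
  rw [← LinearMap.range_eq_top, eq_top_iff, ← TensorProduct.span_tmul_eq_top, Submodule.span_le]
  rintro _ ⟨a, h, rfl⟩
  exact ⟨_, canonicalMap_canonicalPreimage hα a h⟩

theorem canonicalMap_bijective (hα : α.IsNondegenerate) :
    Function.Bijective (canonicalMap k G (galoisAlgebra S α)) :=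
  have := finite (α := α)
  canonicalMap_bijective_of_surjective finrank_le (canonicalMap_surjective hα)

theorem isGaloisObject (hα : α.IsNondegenerate) : IsGaloisObject k G (galoisAlgebra S α) :=
  ⟨coaction_eq_tmul_one_iff hα, canonicalMap_bijective hα⟩

theorem translation_eq (hα : α.IsNondegenerate) (hA : IsGaloisObject k G (galoisAlgebra S α))
    (h : G → k) : hA.translation h = canonicalPreimage 1 h := by
  rw [IsGaloisObject.translation, LinearEquiv.symm_apply_eq, LinearEquiv.ofBijective_apply,
    canonicalMap_canonicalPreimage hα]

/-- The Miyashita-Ulbrich action on `A(G,S,α)`: the idempotent `e_g` acts by projecting `a(q)`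
to the line spanned by `x_{q g q⁻¹}`. -/
theorem miyashitaUlbrich_eq (hα : α.IsNondegenerate)
    (hA : IsGaloisObject k G (galoisAlgebra S α)) (a : galoisAlgebra S α) (h : G → k) :
    hA.miyashitaUlbrich a h = ∑ g : G, h g • component g a := by
  have h1 (g : G) := sum_single_mul_smul_single hα g 1 a
  simp only [one_smul, inv_one, mul_one] at h1
  rw [IsGaloisObject.miyashitaUlbrich, translation_eq hα, canonicalPreimage]
  simp only [one_mul, map_smul, map_sum, TensorProduct.lift.tmul, LinearMap.comp_apply,
    LinearMap.mulRight_apply, LinearMap.mul_apply', h1]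
  simp only [smul_comm _ (Fintype.card S : k), ← Finset.smul_sum]
  rw [smul_inv_smul₀ card_subgroup_ne_zero]

theorem isMUSubmodule_iff (hα : α.IsNondegenerate)
    (hA : IsGaloisObject k G (galoisAlgebra S α)) (B : Submodule k (galoisAlgebra S α)) :
    hA.IsMUSubmodule B ↔ ∀ a ∈ B, ∀ g, component g a ∈ B := by
  refine ⟨fun H a ha g => ?_, fun H a ha h => ?_⟩
  · have h1 := H a ha (Pi.single g 1)
    rw [miyashitaUlbrich_eq hα, Finset.sum_eq_single g] at h1
    · simpa using h1
    · intro g' _ hg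
      rw [Pi.single_eq_of_ne hg, zero_smul]
    · simp
  · rw [miyashitaUlbrich_eq hα]
    exact B.sum_mem fun g _ => B.smul_mem _ (H a ha g)

end Finite

/-! ### Supports of invariants and regular pairs. -/

section Invariants

variable (F : Subgroup G)

theorem mem_fixed_iff {a : galoisAlgebra S α} :
    a ∈ (FixedPoints.subalgebra k (galoisAlgebra S α) F).toSubmodule ↔
      ∀ f ∈ F, ∀ q, ev (q * f) a = ev q a := by
  constructor
  · intro h f hf q
    conv_rhs => rw [← h ⟨f, hf⟩]
    rfl
  · rintro h ⟨f, hf⟩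
    exact ext_ev fun q => h f hf q

/-- Writing t = qfq⁻¹ with f ∈ F gives tq = qf, so equivariance under t on the left meets invariance
under f on the right. -/
theorem act_ev_of_mem_fixed {a : galoisAlgebra S α}
    (ha : a ∈ (FixedPoints.subalgebra k (galoisAlgebra S α) F).toSubmodule) {q : G} {t : S}
    (ht : (t : G) ∈ conjInv q⁻¹ F) : act α t (ev q a) = ev q a := by
  rw [mem_conjInv, inv_inv] at ht
  rw [← ev_mul_left, ← (mem_fixed_iff F).1 ha _ ht q]
  congr 2
  group

/-- If `x_s` occurs in the value at `q` of an `F`-invariant, then `(q⁻¹, s)` is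
`(α,F)`-regular. -/
theorem isRegularPair_of_proj_ne_zero {a : galoisAlgebra S α}
    (ha : a ∈ (FixedPoints.subalgebra k (galoisAlgebra S α) F).toSubmodule) {q : G} {s : S}
    (h : proj α s (ev q a) ≠ 0) : IsRegularPair α F (q⁻¹, s) := by
  intro t ht htF
  have hcomm : t * s = s * t := Subgroup.mem_centralizer_singleton_iff.1 ht
  -- As t commutes with s and fixes a(q), it fixes the component of a(q) along x_s. Cancelling its
  -- nonzero coordinate shows that x_t and x_s commute.
  have h1 := proj_conj_act α s t (ev q a)
  rw [hcomm, mul_inv_cancel_right, act_ev_of_mem_fixed F ha htF, proj_apply, ← actHom_apply,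
    map_smul, actHom_apply] at h1
  have hc : (basis α).coord s (ev q a) ≠ 0 := fun h0 => h (by rw [proj_apply, h0, zero_smul])
  have h2 := (smul_right_injective _ hc h1).symm
  exact (eq_iff_commute α hcomm.symm).2 ((act_eq_self_iff_commute α).1 h2).symm

open Classical in
/-- Every `x_s` with `(q⁻¹, s)` regular occurs in the value at `q` of some `F`-invariant. -/
theorem exists_mem_fixed_proj_ne_zero [Fintype G] [CharZero k] {q : G} {s : S}
    (h : IsRegularPair α F (q⁻¹, s)) :
    ∃ a ∈ (FixedPoints.subalgebra k (galoisAlgebra S α) F).toSubmodule,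
      proj α s (ev q a) ≠ 0 := by
  -- The witness is the F-orbit sum of the function with value x_s at q.
  refine ⟨∑ f : F, f • single q (x α s), ?_, ?_⟩
  · intro f
    rw [Finset.smul_sum]
    simp only [smul_smul]
    exact Equiv.sum_comp (Equiv.mulLeft f) fun f' : F => f' • single q (x α s)
  · have hterm (f : F) : ev q (f • single q (x α s)) = ev (q * f) (single q (x α s)) := rfl
    -- No cancellation can occur: a nonzero contribution comes from some t = qfq⁻¹ ∈ S commuting
    -- with s, and regularity makes it exactly x_s. The total is a positive multiple of x_s, since f
    -- = 1 contributes, and characteristic zero keeps it nonzero.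
    have hcases (f : F) : proj α s (ev q (f • single q (x α s))) =
        if proj α s (ev q (f • single q (x α s))) = 0 then 0 else x α s := by
      split_ifs with h0
      · exact h0
      · rw [hterm] at h0 ⊢
        by_cases hmem : q * f * q⁻¹ ∈ S
        · rw [ev_single_of_mem _ hmem] at h0 ⊢
          set t : S := ⟨q * f * q⁻¹, hmem⟩ with ht
          obtain ⟨c, hc⟩ := act_x α t s
          have hts : t * s * t⁻¹ = s := by
            by_contra hne
            rw [hc, map_smul, proj_x_of_ne α hne, smul_zero] at h0
            exact h0 rfl
          have hcomm : t * s = s * t := mul_inv_eq_iff_eq_mul.1 hts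
          have hF : (t : G) ∈ conjInv q⁻¹ F := by
            rw [mem_conjInv, ht]
            simp [mul_assoc]
          have hreg := h t (Subgroup.mem_centralizer_singleton_iff.2 hcomm) hF
          rw [(act_eq_self_iff_commute α).2 ((eq_iff_commute α hcomm.symm).1 hreg).symm,
            proj_x_self]
        · rw [ev_single_of_notMem _ hmem, map_zero] at h0
          exact absurd rfl h0
    rw [map_sum, map_sum, Finset.sum_congr rfl fun f _ => hcases f, Finset.sum_ite,
      Finset.sum_const_zero, zero_add, Finset.sum_const, ← Nat.cast_smul_eq_nsmul k]
    refine smul_ne_zero (Nat.cast_ne_zero.2 (Finset.card_ne_zero_of_mem (a := 1) ?_))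
      (x_ne_zero α s)
    rw [Finset.mem_filter, one_smul, ev_single_self, proj_x_self]
    exact ⟨Finset.mem_univ _, x_ne_zero α s⟩

/-- If r and w commute, the two indices coincide. Otherwise neither index commutes with r, so
neither occurs in v and both projections vanish. The element r need not lie in S. -/
theorem projAt_conj_of_regular {v : TwistedGroupAlgebra α} {r w : G}
    (h : ∀ s : S, proj α s v ≠ 0 → Commute r s) :
    projAt (r * w * r⁻¹) v = projAt w v := by
  have key (u : G) (hu : projAt u v ≠ 0) : Commute r u := by
    by_cases hS : u ∈ S
    · lift u to S using hS
      rw [projAt_coe] at hu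
      exact h u hu
    · rw [projAt_of_notMem hS] at hu
      exact absurd rfl hu
  by_cases hw : Commute r w
  · rw [hw.eq, mul_inv_cancel_right]
  · have hw' : ¬ Commute r (r * w * r⁻¹) := fun hc => hw (by
      have h2 : r * (w * r⁻¹) = w := by simpa [Commute, SemiconjBy, mul_assoc] using hc
      rwa [← mul_assoc, mul_inv_eq_iff_eq_mul] at h2)
    rw [not_not.1 fun h0 => hw (key _ h0), not_not.1 fun h0 => hw' (key _ h0)]

theorem component_mem_fixed_iff [Fintype G] [CharZero k] :
    (∀ a ∈ (FixedPoints.subalgebra k (galoisAlgebra S α) F).toSubmodule, ∀ w,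
        component w a ∈ (FixedPoints.subalgebra k (galoisAlgebra S α) F).toSubmodule) ↔
      ∀ (g : G) (s : S), IsRegularPair α F (g, s) →
        conjInv g F ≤ Subgroup.centralizer {(s : G)} := by
  constructor
  · intro H g s hreg r hr
    rw [← inv_inv g] at hreg
    obtain ⟨a, ha, hne⟩ := exists_mem_fixed_proj_ne_zero F hreg
    rw [mem_conjInv] at hr
    -- The index gsg⁻¹ is chosen so that the component at g⁻¹ is the one along x_s. Translating by
    -- grg⁻¹ ∈ F turns s into rsr⁻¹ and leaves the value of a unchanged. Two equal projections, one
    -- of them nonzero, force rsr⁻¹ = s.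
    have h1 := (mem_fixed_iff F).1 (H a ha (g * s * g⁻¹)) _ hr g⁻¹
    rw [ev_component, ev_component, (mem_fixed_iff F).1 ha _ hr,
      show g⁻¹ * (g * s * g⁻¹) * g⁻¹⁻¹ = s by group,
      show g⁻¹ * (g * r * g⁻¹) * (g * s * g⁻¹) * (g⁻¹ * (g * r * g⁻¹))⁻¹ = r * s * r⁻¹ by group,
      projAt_coe] at h1
    rw [Subgroup.mem_centralizer_singleton_iff]
    by_cases hS : r * s * r⁻¹ ∈ S
    · by_contra hcomm
      have hne' : (⟨_, hS⟩ : S) ≠ s := fun h0 => hcomm (mul_inv_eq_iff_eq_mul.1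
        (congrArg Subtype.val h0))
      have h2 := congrArg (proj α s) h1
      rw [show r * s * r⁻¹ = ((⟨_, hS⟩ : S) : G) from rfl, projAt_coe,
        proj_proj_of_ne α hne', proj_proj_self] at h2
      exact hne h2.symm
    · rw [projAt_of_notMem hS] at h1
      exact absurd h1.symm hne
  · intro H a ha w
    refine (mem_fixed_iff F).2 fun f hf q => ?_
    rw [ev_component, ev_component, (mem_fixed_iff F).1 ha f hf,
      show q * f * w * (q * f)⁻¹ = (q * f * q⁻¹) * (q * w * q⁻¹) * (q * f * q⁻¹)⁻¹ by group]
    refine projAt_conj_of_regular fun s hs => ?_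
    have hr : q * f * q⁻¹ ∈ conjInv q⁻¹ F := by
      rw [mem_conjInv]
      simpa [mul_assoc] using hf
    exact Subgroup.mem_centralizer_singleton_iff.1
      (H q⁻¹ s (isRegularPair_of_proj_ne_zero F ha hs) hr)

end Invariants

end galoisAlgebra
end

theorem theorem5p1 {k : Type*} [Field k] [IsAlgClosed k] [CharZero k]
    {G : Type*} [Group G] [Fintype G] [DecidableEq G]
    (S : Subgroup G) (α : TwoCocycle S k) (hα : α.IsNondegenerate) (F : Subgroup G) :
    ∃ hA : IsGaloisObject k G (galoisAlgebra S α),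
      hA.IsMUSubmodule (FixedPoints.subalgebra k (galoisAlgebra S α) F).toSubmodule ↔
        ∀ (g : G) (s : S), IsRegularClass α F (BalancedProduct.mk g s) →
          conjInv g F ≤ Subgroup.centralizer {(s : G)} := by
  have := Fintype.ofFinite S
  have := Fintype.ofFinite (galoisAlgebra.Cosets S)
  refine ⟨galoisAlgebra.isGaloisObject hα, ?_⟩
  rw [galoisAlgebra.isMUSubmodule_iff hα]
  -- Regularity of the class of (g, s) unfolds definitionally to regularity of the pair.
  exact galoisAlgebra.component_mem_fixed_iff F
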